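/- For a continuous, strictly positive, $1$-periodic function $h:\mathbb{R}\to\mathbb{R}$, the firing map of the Perfect Integrator $\dot x=h(t)$ (threshold $1$, reset to $0$) is $$\Phi_h(t):=\inf\Big\{s>t:\ \int_t^{s}h(u)\,du\ge 1\Big\},\qquad t\in\mathbb{R}.$$ It is nondecreasing and satisfies $\Phi_h(t+1)=\Phi_h(t)+1$; its rotation number is $\varrho(\Phi_h)=\lim_{k\to\infty}\Phi_h^k(t)/k$, which does not depend on $t$. Its displacement function is $\Psi_h(t)=\Phi_h(t)-t$. An invariant measure of the firing phase map is a Borel probability measure $\mu$ on $[0,1]$ invariant under $\Phi_h \bmod 1$; the associated interspike-interval distribution is $\mu_{\mathrm{ISI}}(A)=\mu(\{t\in[0,1]:\Psi_h(t)\in A\})$ for Borel $A\subset\mathbb{R}$. Let $f_n$ $(n\in\mathbb{N})$ and $f$ be continuous, strictly positive, $1$-periodic functions on $\mathbb{R}$ such that $f_n\to f$ in $C^0(\mathbb{R})$ (uniformly on compact sets), and suppose that the rotation numbers of the firing maps $\Phi_n:=\Phi_{f_n}$, $n\in\mathbb{N}$, and $\Phi:=\Phi_f$ are all irrational. Then the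 firing phase maps of $\Phi_n$ and $\Phi$ have unique invariant probability measures $\mu^{(n)}$ and $\mu$. These have the densities $$g_n=\frac{f_n}{\int_0^1 f_n(u)\,du},\qquad g=\frac{f}{\int_0^1 f(u)\,du}$$ with respect to Lebesgue measure on $[0,1]$, and $g_n\to g$ uniformly on $[0,1]$. If, in addition, the set $\{t\in[0,1]:\Psi'(t)=0\}$ of critical points of the displacement function $\Psi=\Psi_f$ of the limiting firing map has Lebesgue measure $0$, then $$\sup_{I\in\mathcal{J}}\big|\mu^{(n)}_{\mathrm{ISI}}(I)-\mu_{\mathrm{ISI}}(I)\big|\to 0\qquad (n\to\infty),$$ where $\mathcal{J}$ is the class of all intervals $I\subset[0,1]$ (open, closed or half-closed) and $\mu^{(n)}_{\mathrm{ISI}}$, $\mu_{\mathrm{ISI}}$ are the interspike-interval distributions associated with $\Phi_n,\mu^{(n)}$ and $\Phi,\mu$. -/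

import Mathlib

open MeasureTheory Filter Topology Set

noncomputable section

namespace PerfectIntegrator

/-- The firing map of the perfect integrator `x' = f(t)` with reset value `0` and threshold `1`:
the first time `s > t` at which the solution `x(s; t, 0) = ∫ u in t..s, f u` reaches `1`. -/
def firingMap (f : ℝ → ℝ) (t : ℝ) : ℝ :=
  sInf {s : ℝ | t < s ∧ 1 ≤ ∫ u in t..s, f u}

theorem exists_firing {f : ℝ → ℝ} (hc : Continuous f) (hp : Function.Periodic f 1)
    (hpos : ∀ t, 0 < f t) (t : ℝ) : {s : ℝ | t < s ∧ 1 ≤ ∫ u in t..s, f u}.Nonempty := by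
  have h0 : 0 < ∫ u in (0 : ℝ)..1, f u :=
    intervalIntegral.intervalIntegral_pos_of_pos (hc.intervalIntegrable _ _) hpos one_pos
  obtain ⟨n, hn⟩ := exists_nat_gt (1 / ∫ u in (0 : ℝ)..1, f u)
  have hn0 : (0 : ℝ) < n := lt_trans (by positivity) hn
  refine ⟨t + n, by simpa using hn0, ?_⟩
  have h := hp.intervalIntegral_add_zsmul_eq (n : ℤ) t (fun a b => hc.intervalIntegrable a b)
  rw [hp.intervalIntegral_add_eq t 0] at h
  simp only [zsmul_eq_mul, Int.cast_natCast, mul_one, zero_add] at h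
  rw [h]
  rw [div_lt_iff₀ h0] at hn
  exact hn.le

theorem firingMap_mono {f : ℝ → ℝ} (hc : Continuous f) (hp : Function.Periodic f 1)
    (hpos : ∀ t, 0 < f t) : Monotone (firingMap f) := by
  intro t t' htt
  refine csInf_le_csInf ⟨t, fun s hs => hs.1.le⟩ (exists_firing hc hp hpos t') ?_
  rintro s ⟨hs, h1⟩
  refine ⟨htt.trans_lt hs, ?_⟩
  rw [← intervalIntegral.integral_add_adjacent_intervals
    (hc.intervalIntegrable t t') (hc.intervalIntegrable t' s)]
  have : 0 ≤ ∫ u in t..t', f u :=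
    intervalIntegral.integral_nonneg_of_forall htt (fun u => (hpos u).le)
  linarith

theorem firingMap_add_one {f : ℝ → ℝ} (hc : Continuous f) (hp : Function.Periodic f 1)
    (hpos : ∀ t, 0 < f t) (t : ℝ) : firingMap f (t + 1) = firingMap f t + 1 := by
  have hset : {s : ℝ | t + 1 < s ∧ 1 ≤ ∫ u in (t + 1)..s, f u} =
      OrderIso.addRight (1 : ℝ) '' {s : ℝ | t < s ∧ 1 ≤ ∫ u in t..s, f u} := by
    have hint : ∀ s, ∫ u in (t + 1)..(s + 1), f u = ∫ u in t..s, f u := by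
      intro s
      rw [← intervalIntegral.integral_comp_add_right (fun u => f u) 1]
      simp only [hp _]
    ext s
    constructor
    · rintro ⟨h1, h2⟩
      refine ⟨s - 1, ⟨by linarith, ?_⟩, by simp⟩
      rw [← hint]
      simpa using h2
    · rintro ⟨r, ⟨h1, h2⟩, rfl⟩
      refine ⟨by simpa using h1, ?_⟩
      rw [← hint] at h2
      simpa using h2
  unfold firingMap
  rw [hset, ← OrderIso.map_csInf' (OrderIso.addRight (1 : ℝ)) (exists_firing hc hp hpos t)
    ⟨t, fun s hs => hs.1.le⟩]
  simp

/-- For a continuous, positive, `1`-periodic input the firing map is a lift of a monotone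
degree one circle map (the firing phase map). Its rotation number `lim Φⁿ(t) / n` is
`CircleDeg1Lift.translationNumber`. -/
def firingLift (f : C(ℝ, ℝ)) (hp : Function.Periodic f 1) (hpos : ∀ t, 0 < f t) :
    CircleDeg1Lift where
  toFun := firingMap f
  monotone' := firingMap_mono f.continuous hp hpos
  map_add_one' := firingMap_add_one f.continuous hp hpos

/-- `μ` is an invariant Borel probability measure of the firing phase map, realised as
`Φ mod 1 : [0,1] → [0,1]`; measures on `[0,1]` are Borel measures on `ℝ` vanishing outside
`[0,1]`. -/
def IsInvariantPhaseMeasure (Φ : ℝ → ℝ) (μ : Measure ℝ) : Prop :=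
  IsProbabilityMeasure μ ∧ μ (Icc 0 1)ᶜ = 0 ∧ MeasurePreserving (fun t => Int.fract (Φ t)) μ μ

/-- The displacement function `Ψ(t) = Φ(t) - t`. -/
def displacement (Φ : ℝ → ℝ) (t : ℝ) : ℝ := Φ t - t

/-- The interspike-interval distribution `A ↦ μ {t ∈ [0,1] | Φ(t) - t ∈ A}`. -/
def isiDistribution (Φ : ℝ → ℝ) (μ : Measure ℝ) : Measure ℝ :=
  (μ.restrict (Icc 0 1)).map (displacement Φ)

/-- The set of critical points in `[0,1]` of the displacement function. -/
def criticalSet (Φ : ℝ → ℝ) : Set ℝ :=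
  {t | t ∈ Icc (0 : ℝ) 1 ∧ HasDerivAt (displacement Φ) 0 t}

/-- The function `f / ∫₀¹ f`. -/
def normalizedInput (f : ℝ → ℝ) (t : ℝ) : ℝ := f t / ∫ u in (0 : ℝ)..1, f u

/-- `g` is a density of `μ` with respect to Lebesgue measure on `[0,1]`. -/
def HasDensityOnUnit (μ : Measure ℝ) (g : ℝ → ℝ) : Prop :=
  μ = (volume.restrict (Icc (0 : ℝ) 1)).withDensity (fun t => ENNReal.ofReal (g t))

end PerfectIntegrator

end

open PerfectIntegrator

noncomputable section

namespace PerfectIntegrator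

/-! Put c = ∫₀¹ f. The firing map adds 1 to the primitive of f, so the primitive divided by c
(`phase`) conjugates it to translation by 1/c. Hence the rotation number is 1/c and the firing phase
map is a circle rotation in disguise. For irrational 1/c, Fourier coefficients show that Lebesgue
measure is the only invariant probability measure of the rotation (`eq_of_map_add_eq`); pulled back
by the phase it has density f/c, and uniform convergence of the densities is then elementary.

For the interval statement two errors add up. Changing the measure costs at most the sup distance of
the densities, uniformly over all Borel sets. Changing the displacement function moves its values by
at most δ (`abs_firingMap_sub_le`), which matters only where the limiting displacement is δ-close to
an endpoint of I. The limiting distribution has no atoms, because a level set of Ψ is critical up to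
countably many points (`volume_level_eq_zero`); by compactness δ-balls have uniformly small mass
(`exists_forall_measureReal_closedBall_le`). -/

/-- The normalized primitive of `f`; it conjugates the firing map to a translation. -/
def phase (f : ℝ → ℝ) (t : ℝ) : ℝ := (∫ u in (0 : ℝ)..t, f u) / ∫ u in (0 : ℝ)..1, f u

/-! ### Conjugating the firing map to a translation. -/

section Phase

variable {f : ℝ → ℝ}

theorem integral_unit_pos (hc : Continuous f) (hpos : ∀ t, 0 < f t) :
    0 < ∫ u in (0 : ℝ)..1, f u :=
  intervalIntegral.intervalIntegral_pos_of_pos (hc.intervalIntegrable _ _) hpos one_pos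

theorem hasDerivAt_phase (hc : Continuous f) (t : ℝ) :
    HasDerivAt (phase f) (normalizedInput f t) t :=
  (intervalIntegral.integral_hasDerivAt_right (hc.intervalIntegrable _ _)
    (hc.stronglyMeasurableAtFilter _ _) hc.continuousAt).div_const _

theorem continuous_phase (hc : Continuous f) : Continuous (phase f) :=
  continuous_iff_continuousAt.2 fun t => (hasDerivAt_phase hc t).continuousAt

theorem normalizedInput_pos (hc : Continuous f) (hpos : ∀ t, 0 < f t) (t : ℝ) :
    0 < normalizedInput f t :=
  div_pos (hpos t) (integral_unit_pos hc hpos)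

theorem strictMono_phase (hc : Continuous f) (hpos : ∀ t, 0 < f t) : StrictMono (phase f) :=
  strictMono_of_hasDerivAt_pos (fun t => hasDerivAt_phase hc t) (normalizedInput_pos hc hpos)

theorem phase_zero : phase f 0 = 0 := by simp [phase]

theorem phase_one (hc : Continuous f) (hpos : ∀ t, 0 < f t) : phase f 1 = 1 :=
  div_self (integral_unit_pos hc hpos).ne'

theorem phase_sub_phase (hc : Continuous f) (s t : ℝ) :
    phase f s - phase f t = (∫ u in t..s, f u) / ∫ u in (0 : ℝ)..1, f u := by
  rw [phase, phase, ← sub_div, intervalIntegral.integral_interval_sub_left]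
  exacts [hc.intervalIntegrable _ _, hc.intervalIntegrable _ _]

theorem phase_add_one (hc : Continuous f) (hp : Function.Periodic f 1) (hpos : ∀ t, 0 < f t)
    (t : ℝ) : phase f (t + 1) = phase f t + 1 := by
  have h := phase_sub_phase hc (t + 1) t
  rw [hp.intervalIntegral_add_eq t 0, zero_add, div_self (integral_unit_pos hc hpos).ne'] at h
  linarith

/-- The phase as a lift of a degree one circle map. -/
def phaseLift (hc : Continuous f) (hp : Function.Periodic f 1) (hpos : ∀ t, 0 < f t) :
    CircleDeg1Lift where
  toFun := phase f
  monotone' := (strictMono_phase hc hpos).monotone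
  map_add_one' := phase_add_one hc hp hpos

theorem phase_sub_int (hc : Continuous f) (hp : Function.Periodic f 1) (hpos : ∀ t, 0 < f t)
    (t : ℝ) (m : ℤ) : phase f (t - m) = phase f t - m :=
  (phaseLift hc hp hpos).map_sub_int t m

theorem surjective_phase (hc : Continuous f) (hp : Function.Periodic f 1) (hpos : ∀ t, 0 < f t) :
    Function.Surjective (phase f) :=
  (phaseLift hc hp hpos).continuous_iff_surjective.1 (continuous_phase hc)

/-- The phase as an order isomorphism of the line. -/
def phaseIso (hc : Continuous f) (hp : Function.Periodic f 1) (hpos : ∀ t, 0 < f t) : ℝ ≃o ℝ :=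
  (strictMono_phase hc hpos).orderIsoOfSurjective _ (surjective_phase hc hp hpos)

@[simp]
theorem coe_phaseIso (hc : Continuous f) (hp : Function.Periodic f 1) (hpos : ∀ t, 0 < f t) :
    ⇑(phaseIso hc hp hpos) = phase f := rfl

@[simp]
theorem phase_phaseIso_symm (hc : Continuous f) (hp : Function.Periodic f 1)
    (hpos : ∀ t, 0 < f t) (x : ℝ) : phase f ((phaseIso hc hp hpos).symm x) = x :=
  (phaseIso hc hp hpos).apply_symm_apply x

@[simp]
theorem phaseIso_symm_phase (hc : Continuous f) (hp : Function.Periodic f 1)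
    (hpos : ∀ t, 0 < f t) (t : ℝ) : (phaseIso hc hp hpos).symm (phase f t) = t :=
  (phaseIso hc hp hpos).symm_apply_apply t

theorem phase_mem_Ico_iff (hc : Continuous f) (hpos : ∀ t, 0 < f t) {t : ℝ} :
    phase f t ∈ Ico (0 : ℝ) 1 ↔ t ∈ Ico (0 : ℝ) 1 := by
  have h := strictMono_phase hc hpos
  have h0 : (0 : ℝ) ≤ phase f t ↔ 0 ≤ t := by simpa only [phase_zero] using h.le_iff_le (a := 0) (b := t)
  have h1 : phase f t < 1 ↔ t < 1 := by simpa only [phase_one hc hpos] using h.lt_iff_lt (a := t) (b := 1)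
  rw [mem_Ico, mem_Ico, h0, h1]

/-- The integral from t to s reaches 1 exactly when the phase has advanced by 1/∫₀¹f. The phase is
strictly increasing, so the set defining the infimum is a closed half-line; its left end exceeds t,
which makes the condition t < s automatic. -/
theorem firingMap_eq (hc : Continuous f) (hp : Function.Periodic f 1) (hpos : ∀ t, 0 < f t)
    (t : ℝ) : firingMap f t =
      (phaseIso hc hp hpos).symm (phase f t + 1 / ∫ u in (0 : ℝ)..1, f u) := by
  set s₀ := (phaseIso hc hp hpos).symm (phase f t + 1 / ∫ u in (0 : ℝ)..1, f u) with hs₀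
  have hc0 := integral_unit_pos hc hpos
  have hs : phase f s₀ = phase f t + 1 / ∫ u in (0 : ℝ)..1, f u := phase_phaseIso_symm hc hp hpos _
  have hset : {s : ℝ | t < s ∧ 1 ≤ ∫ u in t..s, f u} = Ici s₀ := by
    ext s
    have key : (1 ≤ ∫ u in t..s, f u) ↔ s₀ ≤ s := by
      rw [← (strictMono_phase hc hpos).le_iff_le (a := s₀), hs, ← le_sub_iff_add_le',
        phase_sub_phase hc, div_le_div_iff_of_pos_right hc0]
    have hlt : t < s₀ := by
      rw [← (strictMono_phase hc hpos).lt_iff_lt, hs]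
      exact lt_add_of_pos_right _ (by positivity)
    rw [mem_ofPred_eq, key, mem_Ici]
    exact ⟨fun h => h.2, fun h => ⟨hlt.trans_le h, h⟩⟩
  rw [firingMap, hset, csInf_Ici]

theorem phase_firingMap (hc : Continuous f) (hp : Function.Periodic f 1) (hpos : ∀ t, 0 < f t)
    (t : ℝ) : phase f (firingMap f t) = phase f t + 1 / ∫ u in (0 : ℝ)..1, f u := by
  rw [firingMap_eq hc hp hpos, phase_phaseIso_symm]

theorem integral_firingMap (hc : Continuous f) (hp : Function.Periodic f 1) (hpos : ∀ t, 0 < f t)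
    (t : ℝ) : ∫ u in t..firingMap f t, f u = 1 := by
  have h := phase_sub_phase hc (firingMap f t) t
  rw [phase_firingMap hc hp hpos, add_sub_cancel_left] at h
  field_simp [(integral_unit_pos hc hpos).ne'] at h
  exact h.symm

theorem translationNumber_firingLift (f : C(ℝ, ℝ)) (hp : Function.Periodic f 1)
    (hpos : ∀ t, 0 < f t) :
    (firingLift f hp hpos).translationNumber = 1 / ∫ u in (0 : ℝ)..1, f u := by
  have h : Function.Semiconj (phaseLift f.continuous hp hpos) (firingLift f hp hpos)
      (CircleDeg1Lift.translate (Multiplicative.ofAdd (1 / ∫ u in (0 : ℝ)..1, f u))) := by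
    intro t
    rw [CircleDeg1Lift.translate_apply, add_comm]
    exact phase_firingMap f.continuous hp hpos t
  rw [CircleDeg1Lift.translationNumber_eq_of_semiconj h,
    CircleDeg1Lift.translationNumber_translate]

theorem continuous_phaseIso_symm (hc : Continuous f) (hp : Function.Periodic f 1)
    (hpos : ∀ t, 0 < f t) : Continuous (phaseIso hc hp hpos).symm :=
  (phaseIso hc hp hpos).symm.continuous

theorem continuous_firingMap (hc : Continuous f) (hp : Function.Periodic f 1)
    (hpos : ∀ t, 0 < f t) : Continuous (firingMap f) := by
  rw [funext (firingMap_eq hc hp hpos)]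
  exact (continuous_phaseIso_symm hc hp hpos).comp ((continuous_phase hc).add_const _)

theorem continuous_displacement (hc : Continuous f) (hp : Function.Periodic f 1)
    (hpos : ∀ t, 0 < f t) : Continuous (displacement (firingMap f)) :=
  (continuous_firingMap hc hp hpos).sub continuous_id

theorem hasDerivAt_displacement (hc : Continuous f) (hp : Function.Periodic f 1)
    (hpos : ∀ t, 0 < f t) (t : ℝ) :
    ∃ d, HasDerivAt (displacement (firingMap f)) d t := by
  set α := 1 / ∫ u in (0 : ℝ)..1, f u
  have hinv : HasDerivAt (phaseIso hc hp hpos).symm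
      (normalizedInput f ((phaseIso hc hp hpos).symm (phase f t + α)))⁻¹ (phase f t + α) :=
    (hasDerivAt_phase hc _).of_local_left_inverse
      (continuous_phaseIso_symm hc hp hpos).continuousAt (normalizedInput_pos hc hpos _).ne'
      (Eventually.of_forall (phase_phaseIso_symm hc hp hpos))
  have h := (hinv.comp t ((hasDerivAt_phase hc t).add_const α)).sub (hasDerivAt_id t)
  refine ⟨_, h.congr_of_eventuallyEq (Eventually.of_forall fun s => ?_)⟩
  simp only [displacement, firingMap_eq hc hp hpos]
  rfl

end Phase

/-! ### Unique ergodicity of irrational rotations. -/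

theorem fourier_coe_ne_one {α : ℝ} (hα : Irrational α) {k : ℤ} (hk : k ≠ 0) :
    (fourier k (α : UnitAddCircle) : ℂ) ≠ 1 := by
  intro h
  rw [fourier_coe_apply, Complex.exp_eq_one_iff] at h
  obtain ⟨m, hm⟩ := h
  have hπ : (2 * Real.pi * Complex.I : ℂ) ≠ 0 := Complex.two_pi_I_ne_zero
  have h1 : (k : ℂ) * α = m := by
    apply mul_left_cancel₀ hπ
    rw [Complex.ofReal_one, div_one] at hm
    linear_combination hm
  have h2 : (k : ℝ) * α = m := by exact_mod_cast h1
  exact (hα.intCast_mul hk).ne_int m h2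

/-- Rotation by α multiplies the k-th character by its value at α, which is not 1; invariance
therefore forces its integral to vanish. -/
theorem integral_fourier_eq_zero {α : ℝ} (hα : Irrational α) {ν : Measure UnitAddCircle}
    (hν : ν.map (· + (α : UnitAddCircle)) = ν) {k : ℤ} (hk : k ≠ 0) :
    ∫ x, (fourier k x : ℂ) ∂ν = 0 := by
  have h : ∫ x, (fourier k x : ℂ) ∂ν =
      (∫ x, (fourier k x : ℂ) ∂ν) * fourier k (α : UnitAddCircle) := by
    conv_lhs => rw [← hν]
    rw [integral_map (by fun_prop) (map_continuous _).aestronglyMeasurable, ← integral_mul_const]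
    congr with x
    simp only [fourier_apply, smul_add, AddCircle.toCircle_add, Circle.coe_mul]
  have h' : (∫ x, (fourier k x : ℂ) ∂ν) * (fourier k (α : UnitAddCircle) - 1) = 0 := by
    rw [mul_sub, ← h, mul_one, sub_self]
  exact (mul_eq_zero.1 h').resolve_right (sub_ne_zero.2 (fourier_coe_ne_one hα hk))

/-- An irrational rotation of the circle is uniquely ergodic. -/
theorem eq_of_map_add_eq {α : ℝ} (hα : Irrational α) {ν ν' : Measure UnitAddCircle}
    [IsProbabilityMeasure ν] [IsProbabilityMeasure ν']
    (hν : ν.map (· + (α : UnitAddCircle)) = ν) (hν' : ν'.map (· + (α : UnitAddCircle)) = ν') :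
    ν = ν' := by
  -- Trigonometric polynomials form a point-separating star algebra, so their integrals determine a
  -- finite measure. On characters both integrals are 1 for k = 0 and 0 otherwise.
  let A : StarSubalgebra ℂ (BoundedContinuousFunction UnitAddCircle ℂ) :=
    (@fourierSubalgebra 1).comap (BoundedContinuousFunction.toContinuousMapStarₐ ℂ)
  refine ext_of_forall_mem_subalgebra_integral_eq_of_polish (A := A) ?_ ?_
  · intro x y hxy
    obtain ⟨_, ⟨g, hg, rfl⟩, h⟩ := fourierSubalgebra_separatesPoints (T := 1) hxy
    exact ⟨_, ⟨g, ⟨BoundedContinuousFunction.mkOfCompact g, hg, rfl⟩, rfl⟩, h⟩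
  · intro g hg
    have hg' : (g : C(UnitAddCircle, ℂ)) ∈ Submodule.span ℂ (range (@fourier 1)) := by
      rw [← fourierSubalgebra_coe]
      exact hg
    change ∫ x, (g : C(UnitAddCircle, ℂ)) x ∂ν = ∫ x, (g : C(UnitAddCircle, ℂ)) x ∂ν'
    generalize (g : C(UnitAddCircle, ℂ)) = p at hg'
    have hint (μ : Measure UnitAddCircle) [IsProbabilityMeasure μ] (q : C(UnitAddCircle, ℂ)) :
        Integrable (fun x => q x) μ :=
      (BoundedContinuousFunction.mkOfCompact q).integrable μ
    induction hg' using Submodule.span_induction with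
    | mem p hp =>
      obtain ⟨k, rfl⟩ := hp
      rcases eq_or_ne k 0 with rfl | hk
      · simp only [fourier_zero]
        simp
      · rw [integral_fourier_eq_zero hα hν hk, integral_fourier_eq_zero hα hν' hk]
    | zero => simp
    | add p q _ _ hp hq =>
      simp only [ContinuousMap.add_apply]
      rw [integral_add (hint ν p) (hint ν q), integral_add (hint ν' p) (hint ν' q), hp, hq]
    | smul a p _ hp =>
      simp only [ContinuousMap.smul_apply]
      rw [integral_smul, integral_smul, hp]

/-! ### Invariant measures of the firing phase map. -/

section Invariant

variable {f : ℝ → ℝ}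

/-- The point of `[0, 1)` with the given phase. -/
def phasePoint (hc : Continuous f) (hp : Function.Periodic f 1) (hpos : ∀ t, 0 < f t)
    (x : UnitAddCircle) : ℝ :=
  (phaseIso hc hp hpos).symm (AddCircle.measurableEquivIco 1 0 x)

theorem measurable_phasePoint (hc : Continuous f) (hp : Function.Periodic f 1)
    (hpos : ∀ t, 0 < f t) : Measurable (phasePoint hc hp hpos) :=
  (continuous_phaseIso_symm hc hp hpos).measurable.comp
    (measurable_subtype_coe.comp (AddCircle.measurableEquivIco 1 0).measurable)

theorem coe_phase_phasePoint (hc : Continuous f) (hp : Function.Periodic f 1)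
    (hpos : ∀ t, 0 < f t) (x : UnitAddCircle) :
    (phase f (phasePoint hc hp hpos x) : UnitAddCircle) = x := by
  rw [phasePoint, phase_phaseIso_symm]
  exact (AddCircle.measurableEquivIco 1 0).symm_apply_apply x

theorem phasePoint_coe_phase (hc : Continuous f) (hp : Function.Periodic f 1)
    (hpos : ∀ t, 0 < f t) {t : ℝ} (ht : t ∈ Ico (0 : ℝ) 1) :
    phasePoint hc hp hpos (phase f t : UnitAddCircle) = t := by
  have h : phase f t ∈ Ico (0 : ℝ) (0 + 1) := by
    rw [zero_add]; exact (phase_mem_Ico_iff hc hpos).2 ht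
  have := (AddCircle.measurableEquivIco 1 0).apply_symm_apply ⟨phase f t, h⟩
  have h2 : AddCircle.measurableEquivIco 1 0 (phase f t : UnitAddCircle) = ⟨phase f t, h⟩ := this
  rw [phasePoint, h2, phaseIso_symm_phase]

/-- The phase modulo one conjugates the firing phase map to a rotation. -/
theorem coe_phase_fract_firingMap (hc : Continuous f) (hp : Function.Periodic f 1)
    (hpos : ∀ t, 0 < f t) (t : ℝ) :
    (phase f (Int.fract (firingMap f t)) : UnitAddCircle) =
      (phase f t : UnitAddCircle) + ((1 / ∫ u in (0 : ℝ)..1, f u : ℝ) : UnitAddCircle) := by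
  rw [Int.fract, phase_sub_int hc hp hpos, phase_firingMap hc hp hpos, AddCircle.coe_sub,
    AddCircle.coe_add, sub_eq_self]
  have := AddCircle.coe_period (1 : ℝ)
  rw [← mul_one ((⌊firingMap f t⌋ : ℤ) : ℝ), ← zsmul_eq_mul, AddCircle.coe_zsmul, this, smul_zero]

theorem measurable_coe_phase (hc : Continuous f) :
    Measurable (fun t => (phase f t : UnitAddCircle)) :=
  AddCircle.measurable_mk'.comp (continuous_phase hc).measurable

theorem measurable_fract_firingMap (hc : Continuous f) (hp : Function.Periodic f 1)
    (hpos : ∀ t, 0 < f t) : Measurable fun t => Int.fract (firingMap f t) :=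
  measurable_fract.comp (continuous_firingMap hc hp hpos).measurable

theorem map_phasePoint_map_phase (hc : Continuous f) (hp : Function.Periodic f 1)
    (hpos : ∀ t, 0 < f t) {μ : Measure ℝ} (hμ : μ (Ico 0 1)ᶜ = 0) :
    (μ.map (fun t => (phase f t : UnitAddCircle))).map (phasePoint hc hp hpos) = μ := by
  rw [Measure.map_map (measurable_phasePoint hc hp hpos) (measurable_coe_phase hc)]
  conv_rhs => rw [← Measure.map_id (μ := μ)]
  refine Measure.map_congr ?_
  have h : ∀ᵐ t ∂μ, t ∈ Ico (0 : ℝ) 1 := hμ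
  filter_upwards [h] with t ht using phasePoint_coe_phase hc hp hpos ht

/-- `Int.fract` takes values in [0,1), so invariance excludes mass at the endpoint 1, where the
phase modulo one would not be injective. -/
theorem measure_compl_Ico_of_invariant (hc : Continuous f) (hp : Function.Periodic f 1)
    (hpos : ∀ t, 0 < f t) {μ : Measure ℝ} (hμ : IsInvariantPhaseMeasure (firingMap f) μ) :
    μ (Ico 0 1)ᶜ = 0 := by
  have h := hμ.2.2.map_eq
  rw [← h, Measure.map_apply (measurable_fract_firingMap hc hp hpos) measurableSet_Ico.compl]
  convert! measure_empty (μ := μ)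
  ext t
  simp [Int.fract_nonneg, Int.fract_lt_one]

theorem map_phase_add_of_invariant (hc : Continuous f) (hp : Function.Periodic f 1)
    (hpos : ∀ t, 0 < f t) {μ : Measure ℝ} (hμ : IsInvariantPhaseMeasure (firingMap f) μ) :
    (μ.map (fun t => (phase f t : UnitAddCircle))).map
      (· + ((1 / ∫ u in (0 : ℝ)..1, f u : ℝ) : UnitAddCircle)) =
      μ.map (fun t => (phase f t : UnitAddCircle)) := by
  rw [Measure.map_map (by fun_prop) (measurable_coe_phase hc)]
  conv_rhs => rw [← hμ.2.2.map_eq]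
  rw [Measure.map_map (measurable_coe_phase hc) (measurable_fract_firingMap hc hp hpos)]
  congr 1 with t
  exact (coe_phase_fract_firingMap hc hp hpos t).symm

/-- The measure on `[0, 1]` with density `f / ∫₀¹ f`. -/
def normalizedMeasure (f : ℝ → ℝ) : Measure ℝ :=
  (volume.restrict (Icc (0 : ℝ) 1)).withDensity (fun t => ENNReal.ofReal (normalizedInput f t))

theorem normalizedMeasure_compl_Ico : normalizedMeasure f (Ico 0 1)ᶜ = 0 := by
  refine withDensity_absolutelyContinuous _ _ ?_
  rw [restrict_Ico_eq_restrict_Icc.symm]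
  exact Measure.restrict_apply_eq_zero measurableSet_Ico.compl |>.2 (by simp)

/-- Change of variables: the density is the derivative of the phase, which maps [0,1] bijectively
onto itself. -/
theorem map_phase_normalizedMeasure (hc : Continuous f) (hp : Function.Periodic f 1)
    (hpos : ∀ t, 0 < f t) :
    (normalizedMeasure f).map (phase f) = volume.restrict (Icc (0 : ℝ) 1) := by
  have himg : phase f '' Icc 0 1 = Icc 0 1 := by
    rw [← coe_phaseIso hc hp hpos, OrderIso.image_Icc, coe_phaseIso, phase_zero,
      phase_one hc hpos]
  ext s hs
  have hm := (continuous_phase hc).measurable hs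
  rw [Measure.map_apply (continuous_phase hc).measurable hs, normalizedMeasure,
    withDensity_apply _ hm, Measure.restrict_restrict hm, Measure.restrict_apply hs]
  have h := lintegral_image_eq_lintegral_abs_deriv_mul (hm.inter measurableSet_Icc)
    (fun x _ => (hasDerivAt_phase hc x).hasDerivWithinAt)
    (strictMono_phase hc hpos).injective.injOn (fun _ => (1 : ENNReal))
    (s := phase f ⁻¹' s ∩ Icc 0 1)
  rw [lintegral_one, Measure.restrict_apply_univ, inter_comm, image_inter_preimage, himg,
    inter_comm] at h
  rw [h, inter_comm]
  refine lintegral_congr fun x => ?_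
  rw [mul_one, abs_of_pos (normalizedInput_pos hc hpos x)]

theorem map_coe_phase_normalizedMeasure (hc : Continuous f) (hp : Function.Periodic f 1)
    (hpos : ∀ t, 0 < f t) :
    (normalizedMeasure f).map (fun t => (phase f t : UnitAddCircle)) = volume := by
  have h := (UnitAddCircle.measurePreserving_mk 0).map_eq
  rw [zero_add, restrict_Ioc_eq_restrict_Icc, ← map_phase_normalizedMeasure hc hp hpos,
    Measure.map_map AddCircle.measurable_mk' (continuous_phase hc).measurable] at h
  exact h

theorem map_phasePoint_volume (hc : Continuous f) (hp : Function.Periodic f 1)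
    (hpos : ∀ t, 0 < f t) :
    (volume : Measure UnitAddCircle).map (phasePoint hc hp hpos) = normalizedMeasure f := by
  rw [← map_coe_phase_normalizedMeasure hc hp hpos]
  exact map_phasePoint_map_phase hc hp hpos normalizedMeasure_compl_Ico

theorem fract_firingMap_phasePoint (hc : Continuous f) (hp : Function.Periodic f 1)
    (hpos : ∀ t, 0 < f t) (x : UnitAddCircle) :
    Int.fract (firingMap f (phasePoint hc hp hpos x)) =
      phasePoint hc hp hpos (x + ((1 / ∫ u in (0 : ℝ)..1, f u : ℝ) : UnitAddCircle)) := by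
  have h := coe_phase_fract_firingMap hc hp hpos (phasePoint hc hp hpos x)
  rw [coe_phase_phasePoint] at h
  rw [← h, phasePoint_coe_phase hc hp hpos ⟨Int.fract_nonneg _, Int.fract_lt_one _⟩]

theorem isProbabilityMeasure_volume_unitAddCircle :
    IsProbabilityMeasure (volume : Measure UnitAddCircle) :=
  ⟨UnitAddCircle.measure_univ⟩

theorem isProbabilityMeasure_normalizedMeasure (hc : Continuous f) (hp : Function.Periodic f 1)
    (hpos : ∀ t, 0 < f t) : IsProbabilityMeasure (normalizedMeasure f) := by
  have := isProbabilityMeasure_volume_unitAddCircle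
  rw [← map_phasePoint_volume hc hp hpos]
  exact Measure.isProbabilityMeasure_map (measurable_phasePoint hc hp hpos).aemeasurable

theorem isInvariantPhaseMeasure_normalizedMeasure (hc : Continuous f)
    (hp : Function.Periodic f 1) (hpos : ∀ t, 0 < f t) :
    IsInvariantPhaseMeasure (firingMap f) (normalizedMeasure f) := by
  refine ⟨isProbabilityMeasure_normalizedMeasure hc hp hpos,
    measure_mono_null (compl_subset_compl.2 Ico_subset_Icc_self) normalizedMeasure_compl_Ico,
    measurable_fract_firingMap hc hp hpos, ?_⟩
  rw [← map_phasePoint_volume hc hp hpos, Measure.map_map (measurable_fract_firingMap hc hp hpos)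
    (measurable_phasePoint hc hp hpos), show (fun t => Int.fract (firingMap f t)) ∘
      phasePoint hc hp hpos = phasePoint hc hp hpos ∘
        (· + ((1 / ∫ u in (0 : ℝ)..1, f u : ℝ) : UnitAddCircle)) from
      funext (fract_firingMap_phasePoint hc hp hpos),
    ← Measure.map_map (measurable_phasePoint hc hp hpos) (by fun_prop),
    map_add_right_eq_self]

theorem eq_normalizedMeasure_of_invariant (hc : Continuous f) (hp : Function.Periodic f 1)
    (hpos : ∀ t, 0 < f t) (hirr : Irrational (1 / ∫ u in (0 : ℝ)..1, f u)) {μ : Measure ℝ}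
    (hμ : IsInvariantPhaseMeasure (firingMap f) μ) : μ = normalizedMeasure f := by
  have := hμ.1
  have := isProbabilityMeasure_volume_unitAddCircle
  have : IsProbabilityMeasure (μ.map (fun t => (phase f t : UnitAddCircle))) :=
    Measure.isProbabilityMeasure_map (measurable_coe_phase hc).aemeasurable
  rw [← map_phasePoint_map_phase hc hp hpos (measure_compl_Ico_of_invariant hc hp hpos hμ),
    ← map_phasePoint_volume hc hp hpos,
    eq_of_map_add_eq hirr (map_phase_add_of_invariant hc hp hpos hμ)
      (map_add_right_eq_self (volume : Measure UnitAddCircle) _)]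

end Invariant

/-! ### Stability of interval probabilities under small perturbations. -/

section IsiConvergence

open Metric

/-- Around each point some closed ball has mass at most ε, since the masses shrink to that of the
point. A Lebesgue number for the resulting cover of K makes the radius uniform. -/
theorem exists_forall_measureReal_closedBall_le {ν : Measure ℝ} [IsFiniteMeasure ν] {K : Set ℝ}
    (hK : IsCompact K) (hν : ν Kᶜ = 0) (h0 : ∀ a, ν {a} = 0) {ε : ℝ} (hε : 0 < ε) :
    ∃ δ > 0, ∀ a, ν.real (closedBall a δ) ≤ ε := by
  have hr : ∀ a, ∃ r > 0, ν.real (closedBall a r) ≤ ε := by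
    intro a
    have h := tendsto_measure_cthickening_of_isCompact (μ := ν) (isCompact_singleton (x := a))
    rw [h0 a] at h
    have h' := (h.mono_left nhdsWithin_le_nhds).eventually_le_const
      (ENNReal.ofReal_pos.2 hε) |>.and (self_mem_nhdsWithin (a := (0 : ℝ)) (s := Ioi 0))
    obtain ⟨r, h1, h2⟩ := h'.exists
    refine ⟨r, h2, ?_⟩
    rw [cthickening_singleton _ (le_of_lt h2)] at h1
    exact ENNReal.toReal_le_of_le_ofReal hε.le h1
  choose r hr0 hr using hr
  obtain ⟨δ, hδ, h⟩ := lebesgue_number_lemma_of_metric hK (fun a => isOpen_ball (x := a) (ε := r a))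
    (fun a _ => mem_iUnion.2 ⟨a, mem_ball_self (hr0 a)⟩)
  -- If the ball meets K at y, all its points lie within 2δ/3 < δ of y, hence in one member of the
  -- cover.
  refine ⟨δ / 3, by positivity, fun a => ?_⟩
  by_cases hd : Disjoint (closedBall a (δ / 3)) K
  · have : ν (closedBall a (δ / 3)) = 0 := measure_mono_null hd.subset_compl_right hν
    rw [measureReal_def, this]
    exact hε.le
  · obtain ⟨y, hya, hyK⟩ := not_disjoint_iff.1 hd
    obtain ⟨i, hi⟩ := h y hyK
    refine (measureReal_mono ?_).trans (hr i)
    refine Subset.trans (fun z hz => ?_) (hi.trans ball_subset_closedBall)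
    rw [mem_closedBall] at hz hya
    rw [mem_ball]
    linarith [dist_triangle_right z y a]

/-- If `x ∈ I` and `y ∉ I` are at distance at most `δ`, both are close to an end point of `I`. -/
theorem dist_endpoint_le {I : Set ℝ} (hI : I.OrdConnected) (hb : BddBelow I) (ha : BddAbove I)
    {x y δ : ℝ} (hx : x ∈ I) (hy : y ∉ I) (hxy : |x - y| ≤ δ) :
    (|x - sInf I| ≤ δ ∧ |y - sInf I| ≤ δ) ∨ (|x - sSup I| ≤ δ ∧ |y - sSup I| ≤ δ) := by
  rw [abs_le] at hxy
  rcases lt_or_ge y x with h | h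
  · left
    have h1 : sInf I ≤ x := csInf_le hb hx
    have h2 : y ≤ sInf I := le_csInf ⟨x, hx⟩ fun z hz => by
      by_contra! hzy
      exact hy (hI.out hz hx ⟨hzy.le, h.le⟩)
    constructor <;> rw [abs_le] <;> constructor <;> linarith
  · right
    have h1 : x ≤ sSup I := le_csSup ha hx
    have h2 : sSup I ≤ y := csSup_le ⟨x, hx⟩ fun z hz => by
      by_contra! hzy
      exact hy (hI.out hx hz ⟨h, hzy.le⟩)
    constructor <;> rw [abs_le] <;> constructor <;> linarith

/-- The preimages differ only where exactly one of u, v lies in I; there v is within δ of an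
endpoint. The factor 2 counts the endpoints. -/
theorem abs_measureReal_preimage_sub_le {μ : Measure ℝ} [IsFiniteMeasure μ] {u v : ℝ → ℝ}
    (hu : Measurable u) (hv : Measurable v) {δ ε : ℝ} (hδ : ∀ᵐ t ∂μ, |u t - v t| ≤ δ)
    (hε : ∀ a, (μ.map v).real (closedBall a δ) ≤ ε) {I : Set ℝ} (hI : I.OrdConnected)
    (hb : BddBelow I) (ha : BddAbove I) :
    |μ.real (u ⁻¹' I) - μ.real (v ⁻¹' I)| ≤ 2 * ε := by
  have hm := hI.measurableSet
  have hball (a : ℝ) : μ.real (v ⁻¹' closedBall a δ) ≤ ε := by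
    rw [← map_measureReal_apply hv measurableSet_closedBall]
    exact hε a
  refine (abs_measureReal_sub_le_measureReal_symmDiff (hu hm).nullMeasurableSet
    (hv hm).nullMeasurableSet).trans ?_
  have hsub : symmDiff (u ⁻¹' I) (v ⁻¹' I) ≤ᵐ[μ]
      (v ⁻¹' closedBall (sInf I) δ ∪ v ⁻¹' closedBall (sSup I) δ : Set ℝ) := by
    filter_upwards [hδ] with t ht hmem
    rcases hmem with ⟨h1, h2⟩ | ⟨h1, h2⟩
    · exact (dist_endpoint_le hI hb ha h1 h2 ht).imp (fun h => h.2) (fun h => h.2)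
    · rw [abs_sub_comm] at ht
      exact (dist_endpoint_le hI hb ha h1 h2 ht).imp (fun h => h.1) (fun h => h.1)
  calc μ.real (symmDiff (u ⁻¹' I) (v ⁻¹' I))
      ≤ μ.real (v ⁻¹' closedBall (sInf I) δ ∪ v ⁻¹' closedBall (sSup I) δ) :=
        ENNReal.toReal_mono (measure_ne_top _ _) (measure_mono_ae hsub)
    _ ≤ _ := (measureReal_union_le _ _).trans (by linarith [hball (sInf I), hball (sSup I)])

end IsiConvergence

/-! ### Level sets of the displacement function. -/

section LevelSets

/-- All but countably many points of a level set of a differentiable function are critical. -/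
theorem countable_level_noncritical {v : ℝ → ℝ} (hv : ∀ t, ∃ d, HasDerivAt v d t) (y : ℝ) :
    {t | v t = y ∧ ¬ HasDerivAt v 0 t}.Countable := by
  -- A nonzero derivative isolates the point in its level set, and a subset of the line has only
  -- countably many points isolated from the right.
  refine (countable_setOfPred_isolated_right_within (s := v ⁻¹' {y})).mono ?_
  rintro t ⟨hy, ht⟩
  refine ⟨hy, ?_⟩
  obtain ⟨d, hd⟩ := hv t
  have hd0 : d ≠ 0 := by rintro rfl; exact ht hd
  have h : ∀ᶠ z in 𝓝[v ⁻¹' {y} ∩ Ioi t] t, v z ≠ y :=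
    (hd.eventually_ne hd0).filter_mono (nhdsWithin_mono _ fun z hz => ne_of_gt hz.2)
  have h' : ∀ᶠ z in 𝓝[v ⁻¹' {y} ∩ Ioi t] t, v z = y := by
    filter_upwards [self_mem_nhdsWithin] with z hz using hz.1
  rw [← eventually_false_iff_eq_bot]
  filter_upwards [h, h'] with z h1 h2 using h1 h2

theorem volume_level_eq_zero {f : ℝ → ℝ} (hc : Continuous f) (hp : Function.Periodic f 1)
    (hpos : ∀ t, 0 < f t) (hcrit : volume (criticalSet (firingMap f)) = 0) (y : ℝ) :
    volume (displacement (firingMap f) ⁻¹' {y} ∩ Icc 0 1) = 0 := by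
  refine measure_mono_null (t := criticalSet (firingMap f) ∪
    {t | displacement (firingMap f) t = y ∧ ¬ HasDerivAt (displacement (firingMap f)) 0 t}) ?_
    (measure_union_null hcrit ((countable_level_noncritical
      (hasDerivAt_displacement hc hp hpos) y).measure_zero _))
  rintro t ⟨hy, ht⟩
  by_cases h : HasDerivAt (displacement (firingMap f)) 0 t
  · exact Or.inl ⟨ht, h⟩
  · exact Or.inr ⟨hy, h⟩

end LevelSets

/-! ### Dependence of firing maps and densities on the input. -/

section InputConvergence

theorem eventually_forall_abs_sub_lt {f : ℕ → C(ℝ, ℝ)} {f₀ : C(ℝ, ℝ)}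
    (hper : ∀ n, Function.Periodic (f n) 1) (hper₀ : Function.Periodic f₀ 1)
    (hconv : Tendsto f atTop (𝓝 f₀)) {ε : ℝ} (hε : 0 < ε) :
    ∀ᶠ n in atTop, ∀ t, |f n t - f₀ t| < ε := by
  have h := ContinuousMap.tendsto_iff_forall_isCompact_tendstoUniformlyOn.1 hconv _
    (isCompact_Icc (a := (0 : ℝ)) (b := 1))
  filter_upwards [Metric.tendstoUniformlyOn_iff.1 h ε hε] with n hn t
  have h1 : f n (Int.fract t) = f n t := by
    simpa using (hper n).sub_int_mul_eq (x := t) ⌊t⌋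
  have h2 : f₀ (Int.fract t) = f₀ t := by
    simpa using hper₀.sub_int_mul_eq (x := t) ⌊t⌋
  have := hn (Int.fract t) ⟨Int.fract_nonneg t, (Int.fract_lt_one t).le⟩
  rwa [dist_comm, Real.dist_eq, h1, h2] at this

theorem abs_integral_sub_le {f g : ℝ → ℝ} (hf : Continuous f) (hg : Continuous g) {ε : ℝ}
    (h : ∀ t, |f t - g t| ≤ ε) (a b : ℝ) :
    |(∫ u in a..b, f u) - ∫ u in a..b, g u| ≤ ε * |b - a| := by
  rw [← intervalIntegral.integral_sub (hf.intervalIntegrable _ _) (hg.intervalIntegrable _ _)]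
  rw [← Real.norm_eq_abs]
  exact intervalIntegral.norm_integral_le_of_norm_le_const fun x _ => h x

theorem tendsto_integral_unit {f : ℕ → C(ℝ, ℝ)} {f₀ : C(ℝ, ℝ)}
    (hper : ∀ n, Function.Periodic (f n) 1) (hper₀ : Function.Periodic f₀ 1)
    (hconv : Tendsto f atTop (𝓝 f₀)) :
    Tendsto (fun n => ∫ u in (0 : ℝ)..1, f n u) atTop (𝓝 (∫ u in (0 : ℝ)..1, f₀ u)) := by
  rw [Metric.tendsto_nhds]
  intro ε hε
  filter_upwards [eventually_forall_abs_sub_lt hper hper₀ hconv (half_pos hε)] with n hn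
  have := abs_integral_sub_le (f n).continuous f₀.continuous (fun t => (hn t).le) 0 1
  rw [sub_zero, abs_one, mul_one] at this
  rw [Real.dist_eq]
  linarith

theorem tendstoUniformlyOn_normalizedInput {f : ℕ → C(ℝ, ℝ)} {f₀ : C(ℝ, ℝ)}
    (hper : ∀ n, Function.Periodic (f n) 1) (hper₀ : Function.Periodic f₀ 1)
    (hpos₀ : ∀ t, 0 < f₀ t) (hconv : Tendsto f atTop (𝓝 f₀)) :
    TendstoUniformlyOn (fun n => normalizedInput (f n)) (normalizedInput f₀) atTop
      (Icc (0 : ℝ) 1) := by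
  have hsmul := ((tendsto_integral_unit hper hper₀ hconv).inv₀
    (integral_unit_pos f₀.continuous hpos₀).ne').smul hconv
  have h := ContinuousMap.tendsto_iff_forall_isCompact_tendstoUniformlyOn.1 hsmul _
    (isCompact_Icc (a := (0 : ℝ)) (b := 1))
  refine (h.congr (Eventually.of_forall fun n t _ => ?_)).congr_right fun t _ => ?_
  · exact (div_eq_inv_mul _ _).symm
  · exact (div_eq_inv_mul _ _).symm

theorem exists_pos_forall_le {f : ℝ → ℝ} (hc : Continuous f) (hp : Function.Periodic f 1)
    (hpos : ∀ t, 0 < f t) : ∃ m > 0, ∀ t, m ≤ f t := by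
  obtain ⟨x, -, hx⟩ := isCompact_Icc.exists_isMinOn (nonempty_Icc.2 zero_le_one) hc.continuousOn
    (s := Icc (0 : ℝ) 1)
  refine ⟨f x, hpos x, fun t => ?_⟩
  have h2 : f (Int.fract t) = f t := by
    simpa using hp.sub_int_mul_eq (x := t) ⌊t⌋
  rw [← h2]
  exact hx ⟨Int.fract_nonneg t, (Int.fract_lt_one t).le⟩

theorem mul_abs_sub_le_abs_integral {f : ℝ → ℝ} (hc : Continuous f) {m : ℝ} (h : ∀ t, m ≤ f t)
    (a b : ℝ) : m * |b - a| ≤ |∫ u in a..b, f u| := by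
  wlog hab : a ≤ b generalizing a b
  · rw [abs_sub_comm, intervalIntegral.integral_symm, abs_neg]
    exact this b a (le_of_not_ge hab)
  rw [abs_of_nonneg (sub_nonneg.2 hab)]
  refine le_trans ?_ (le_abs_self _)
  have := intervalIntegral.integral_mono_on hab (continuous_const.intervalIntegrable _ _)
    (hc.intervalIntegrable _ _) (fun x _ => h x) (μ := volume)
  rwa [intervalIntegral.integral_const, smul_eq_mul, mul_comm] at this

/-- Both firing integrals equal 1, so the integral of f between the two firing times is, up to sign,
that of f - g from t to the firing time of g. The former is at least m times the gap; the latter is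
at most ε times an interspike interval of length at most 1/m. -/
theorem abs_firingMap_sub_le {f g : ℝ → ℝ} (hf : Continuous f) (hpf : Function.Periodic f 1)
    (hg : Continuous g) (hpg : Function.Periodic g 1) {m ε : ℝ} (hm : 0 < m)
    (hmf : ∀ t, m ≤ f t) (hmg : ∀ t, m ≤ g t) (h : ∀ t, |f t - g t| ≤ ε) (t : ℝ) :
    |firingMap f t - firingMap g t| ≤ ε / m ^ 2 := by
  have hposf (t : ℝ) : 0 < f t := hm.trans_le (hmf t)
  have hposg (t : ℝ) : 0 < g t := hm.trans_le (hmg t)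
  have hε : 0 ≤ ε := (abs_nonneg _).trans (h 0)
  have h1 := integral_firingMap hf hpf hposf t
  have h2 := integral_firingMap hg hpg hposg t
  have h3 := mul_abs_sub_le_abs_integral hg hmg t (firingMap g t)
  rw [h2, abs_one] at h3
  have h4 := mul_abs_sub_le_abs_integral hf hmf (firingMap g t) (firingMap f t)
  have h5 := abs_integral_sub_le hf hg h t (firingMap g t)
  have h6 := intervalIntegral.integral_add_adjacent_intervals
    (hf.intervalIntegrable (μ := volume) t (firingMap g t))
    (hf.intervalIntegrable (firingMap g t) (firingMap f t))
  rw [h1] at h6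
  rw [h2, show (∫ u in t..firingMap g t, f u) - 1 = -∫ u in firingMap g t..firingMap f t, f u by
    linarith, abs_neg] at h5
  rw [le_div_iff₀ (by positivity)]
  calc |firingMap f t - firingMap g t| * m ^ 2
      = m * (m * |firingMap f t - firingMap g t|) := by ring
    _ ≤ m * (ε * |firingMap g t - t|) := mul_le_mul_of_nonneg_left (h4.trans h5) hm.le
    _ = ε * (m * |firingMap g t - t|) := by ring
    _ ≤ ε * 1 := mul_le_mul_of_nonneg_left h3 hε
    _ = ε := mul_one ε

theorem eventually_forall_abs_firingMap_sub_le {f : ℕ → C(ℝ, ℝ)} {f₀ : C(ℝ, ℝ)}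
    (hper : ∀ n, Function.Periodic (f n) 1) (hper₀ : Function.Periodic f₀ 1)
    (hpos₀ : ∀ t, 0 < f₀ t) (hconv : Tendsto f atTop (𝓝 f₀)) {δ : ℝ} (hδ : 0 < δ) :
    ∀ᶠ n in atTop, ∀ t, |firingMap (f n) t - firingMap f₀ t| ≤ δ := by
  obtain ⟨m, hm, hle⟩ := exists_pos_forall_le f₀.continuous hper₀ hpos₀
  -- Closeness m/2 gives both inputs the lower bound m/2; closeness δ(m/2)² then turns the preceding
  -- estimate into δ.
  filter_upwards [eventually_forall_abs_sub_lt hper hper₀ hconv (half_pos hm),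
    eventually_forall_abs_sub_lt hper hper₀ hconv
      (show 0 < δ * (m / 2) ^ 2 by positivity)] with n h1 h2 t
  refine (abs_firingMap_sub_le (f n).continuous (hper n) f₀.continuous hper₀ (half_pos hm)
    (fun t => ?_) (fun t => ?_) (fun t => (h2 t).le) t).trans_eq ?_
  · linarith [hle t, (abs_lt.1 (h1 t)).1]
  · linarith [hle t]
  · field_simp

theorem normalizedMeasure_real_apply {f : ℝ → ℝ} (hc : Continuous f) (hpos : ∀ t, 0 < f t)
    {A : Set ℝ} (hA : MeasurableSet A) :
    (normalizedMeasure f).real A = ∫ t in A ∩ Icc 0 1, normalizedInput f t := by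
  rw [measureReal_def, normalizedMeasure, withDensity_apply _ hA, Measure.restrict_restrict hA,
    integral_eq_lintegral_of_nonneg_ae]
  · exact Eventually.of_forall fun t => (normalizedInput_pos hc hpos t).le
  · exact (hc.div_const _).aestronglyMeasurable

theorem abs_normalizedMeasure_real_sub_le {f g : ℝ → ℝ} (hf : Continuous f)
    (hposf : ∀ t, 0 < f t) (hg : Continuous g) (hposg : ∀ t, 0 < g t) {ε : ℝ} (hε : 0 ≤ ε)
    (h : ∀ t ∈ Icc (0 : ℝ) 1, |normalizedInput f t - normalizedInput g t| ≤ ε)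
    {A : Set ℝ} (hA : MeasurableSet A) :
    |(normalizedMeasure f).real A - (normalizedMeasure g).real A| ≤ ε := by
  have hint {f : ℝ → ℝ} (hf : Continuous f) : IntegrableOn (normalizedInput f) (A ∩ Icc 0 1) :=
    ((hf.div_const _).integrableOn_Icc).mono_set inter_subset_right
  have hvol : volume (A ∩ Icc (0 : ℝ) 1) ≤ 1 :=
    (measure_mono inter_subset_right).trans (by simp)
  rw [normalizedMeasure_real_apply hf hposf hA, normalizedMeasure_real_apply hg hposg hA,
    ← integral_sub (hint hf) (hint hg), ← Real.norm_eq_abs]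
  refine (norm_setIntegral_le_of_norm_le_const (hvol.trans_lt ENNReal.one_lt_top)
    (fun t ht => h t ht.2)).trans ?_
  exact mul_le_of_le_one_right hε (ENNReal.toReal_le_of_le_ofReal zero_le_one (by simpa using hvol))

end InputConvergence

/-! ### Convergence of the interspike-interval distributions. -/

theorem restrict_normalizedMeasure (f : ℝ → ℝ) :
    (normalizedMeasure f).restrict (Icc 0 1) = normalizedMeasure f := by
  refine Measure.restrict_eq_self_of_ae_mem ?_
  exact measure_mono_null (compl_subset_compl.2 Ico_subset_Icc_self) normalizedMeasure_compl_Ico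

theorem isiDistribution_real_apply {f : ℝ → ℝ} (hc : Continuous f) (hp : Function.Periodic f 1)
    (hpos : ∀ t, 0 < f t) {I : Set ℝ} (hI : MeasurableSet I) :
    (isiDistribution (firingMap f) (normalizedMeasure f)).real I =
      (normalizedMeasure f).real (displacement (firingMap f) ⁻¹' I) := by
  rw [isiDistribution, restrict_normalizedMeasure,
    map_measureReal_apply (continuous_displacement hc hp hpos).measurable hI]

theorem tendstoUniformlyOn_isiDistribution {f : ℕ → C(ℝ, ℝ)} {f₀ : C(ℝ, ℝ)}
    (hper : ∀ n, Function.Periodic (f n) 1) (hper₀ : Function.Periodic f₀ 1)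
    (hpos : ∀ n t, 0 < f n t) (hpos₀ : ∀ t, 0 < f₀ t) (hconv : Tendsto f atTop (𝓝 f₀))
    (hcrit : volume (criticalSet (firingMap f₀)) = 0) :
    TendstoUniformlyOn
      (fun (n : ℕ) (I : Set ℝ) =>
        (isiDistribution (firingMap (f n)) (normalizedMeasure (f n))).real I)
      (fun I : Set ℝ => (isiDistribution (firingMap f₀) (normalizedMeasure f₀)).real I) atTop
      {I : Set ℝ | I.OrdConnected ∧ Bornology.IsBounded I} := by
  rw [Metric.tendstoUniformlyOn_iff]
  intro ε hε
  have hprob := isProbabilityMeasure_normalizedMeasure f₀.continuous hper₀ hpos₀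
  have hcont := continuous_displacement f₀.continuous hper₀ hpos₀
  obtain ⟨δ, hδ, hball⟩ := exists_forall_measureReal_closedBall_le
    (ν := (normalizedMeasure f₀).map (displacement (firingMap f₀)))
    ((isCompact_Icc (a := (0 : ℝ)) (b := 1)).image hcont)
    (by
      rw [Measure.map_apply hcont.measurable (isCompact_Icc.image hcont).measurableSet.compl]
      refine measure_mono_null ?_ (normalizedMeasure_compl_Ico (f := f₀))
      exact fun t ht hI => ht (mem_image_of_mem _ (Ico_subset_Icc_self hI)))
    (fun a => by
      rw [Measure.map_apply hcont.measurable (measurableSet_singleton a)]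
      refine withDensity_absolutelyContinuous _ _ ?_
      rw [Measure.restrict_apply (hcont.measurable (measurableSet_singleton a))]
      exact volume_level_eq_zero f₀.continuous hper₀ hpos₀ hcrit a)
    -- Two endpoints at ε/8 each, plus ε/4 for the change of density, total ε/2.
    (show 0 < ε / 8 by positivity)
  filter_upwards [eventually_forall_abs_firingMap_sub_le hper hper₀ hpos₀ hconv hδ,
    Metric.tendstoUniformlyOn_iff.1
      (tendstoUniformlyOn_normalizedInput hper hper₀ hpos₀ hconv) (ε / 4) (by positivity)]
    with n hΦ hg I hI
  have hm := hI.1.measurableSet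
  have hmeas := (continuous_displacement (f n).continuous (hper n) (hpos n)).measurable
  rw [isiDistribution_real_apply f₀.continuous hper₀ hpos₀ hm,
    isiDistribution_real_apply (f n).continuous (hper n) (hpos n) hm, dist_comm, Real.dist_eq]
  have h1 := abs_normalizedMeasure_real_sub_le (f n).continuous (hpos n) f₀.continuous hpos₀
    (show 0 ≤ ε / 4 by positivity)
    (fun t ht => by
      have := hg t ht
      rw [dist_comm, Real.dist_eq] at this
      exact this.le) (hmeas hm)
  have h2 := abs_measureReal_preimage_sub_le (μ := normalizedMeasure f₀) hmeas hcont.measurable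
    (Eventually.of_forall fun t => by
      rw [displacement, displacement, sub_sub_sub_cancel_right]
      exact hΦ t) hball hI.1 hI.2.bddBelow hI.2.bddAbove
  -- The intermediate term pairs the limiting measure with the n-th displacement, separating the
  -- change of measure from the change of map.
  calc _ ≤ _ := abs_sub_le _ ((normalizedMeasure f₀).real (displacement (firingMap (f n)) ⁻¹' I)) _
    _ ≤ ε / 4 + 2 * (ε / 8) := add_le_add h1 h2
    _ < ε := by linarith

theorem existsUnique_isInvariantPhaseMeasure {f : ℝ → ℝ} (hc : Continuous f)
    (hp : Function.Periodic f 1) (hpos : ∀ t, 0 < f t)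
    (hirr : Irrational (1 / ∫ u in (0 : ℝ)..1, f u)) :
    ∃! μ : Measure ℝ, IsInvariantPhaseMeasure (firingMap f) μ :=
  ⟨normalizedMeasure f, isInvariantPhaseMeasure_normalizedMeasure hc hp hpos,
    fun _ hμ => eq_normalizedMeasure_of_invariant hc hp hpos hirr hμ⟩

end PerfectIntegrator

end

theorem mainTheorem12
    (f : ℕ → C(ℝ, ℝ)) (f₀ : C(ℝ, ℝ))
    (hper : ∀ n, Function.Periodic (f n) 1) (hper₀ : Function.Periodic f₀ 1)
    (hpos : ∀ n t, 0 < f n t) (hpos₀ : ∀ t, 0 < f₀ t)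
    -- convergence in `C⁰(ℝ)`, that is, uniformly on compact sets
    (hconv : Tendsto f atTop (𝓝 f₀))
    (hirr : ∀ n, Irrational (firingLift (f n) (hper n) (hpos n)).translationNumber)
    (hirr₀ : Irrational (firingLift f₀ hper₀ hpos₀).translationNumber) :
    (∀ n, ∃! μ : Measure ℝ, IsInvariantPhaseMeasure (firingMap (f n)) μ) ∧
    (∃! μ : Measure ℝ, IsInvariantPhaseMeasure (firingMap f₀) μ) ∧
    ∀ (μ : ℕ → Measure ℝ) (μ₀ : Measure ℝ),
      (∀ n, IsInvariantPhaseMeasure (firingMap (f n)) (μ n)) →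
      IsInvariantPhaseMeasure (firingMap f₀) μ₀ →
      (∀ n, HasDensityOnUnit (μ n) (normalizedInput (f n))) ∧
      HasDensityOnUnit μ₀ (normalizedInput f₀) ∧
      TendstoUniformlyOn (fun n => normalizedInput (f n)) (normalizedInput f₀) atTop
        (Icc (0 : ℝ) 1) ∧
      (volume (criticalSet (firingMap f₀)) = 0 →
        TendstoUniformlyOn
          (fun (n : ℕ) (I : Set ℝ) => (isiDistribution (firingMap (f n)) (μ n)).real I)
          (fun I : Set ℝ => (isiDistribution (firingMap f₀) μ₀).real I) atTop
          {I : Set ℝ | I.OrdConnected ∧ I ⊆ Icc (0 : ℝ) 1}) := by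
  simp only [translationNumber_firingLift] at hirr hirr₀
  refine ⟨fun n => existsUnique_isInvariantPhaseMeasure (f n).continuous (hper n) (hpos n) (hirr n),
    existsUnique_isInvariantPhaseMeasure f₀.continuous hper₀ hpos₀ hirr₀, fun μ μ₀ hμ hμ₀ => ?_⟩
  obtain rfl : μ = fun n => normalizedMeasure (f n) := funext fun n =>
    eq_normalizedMeasure_of_invariant (f n).continuous (hper n) (hpos n) (hirr n) (hμ n)
  obtain rfl := eq_normalizedMeasure_of_invariant f₀.continuous hper₀ hpos₀ hirr₀ hμ₀
  exact ⟨fun n => rfl, rfl, tendstoUniformlyOn_normalizedInput hper hper₀ hpos₀ hconv,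
    fun hcrit => (tendstoUniformlyOn_isiDistribution hper hper₀ hpos hpos₀ hconv hcrit).mono
      fun I hI => ⟨hI.1, Metric.isBounded_Icc 0 1 |>.subset hI.2⟩⟩
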